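/- Let $\sigma>0$, $H,\tilde H\in(0,1)$ with $H\ne\tilde H$, and $\theta\in(0,1)$. Let $B$ and $\tilde B$ be fractional Brownian motions on a common probability space with Hurst exponents $H$ and $\tilde H$, that is, centered Gaussian processes with continuous paths and covariance functions $\tfrac12(t^{2H}+s^{2H}-|t-s|^{2H})$ and $\tfrac12(t^{2\tilde H}+s^{2\tilde H}-|t-s|^{2\tilde H})$, $s,t\ge0$; their joint law is arbitrary. Suppose that there is a single change in the Hurst exponent at $\theta$: the observed process is $Z_t=\sigma B_t$ for $t\in[0,\theta)$ and $Z_t=\xi+\sigma\tilde B_t$ for $t\in[\theta,1]$, where $\xi$ is an arbitrary random level ($\xi=0$ gives $\sigma\tilde B$ itself on $[\theta,1]$, and $\xi=\sigma(B_\theta-\tilde B_\theta)$ gives a continuous process). Observe $Z_{j\Delta_n}$, $j=0,\dots,n$, with $\Delta_n=1/n$, and set $$x_j=(Z_{j\Delta_n}-Z_{(j-1)\Delta_n})^2,\quad 1\le j\le n,\qquad \bar x=\frac1n\sum_{j=1}^n x_j .$$ For given real lag weights $w_n(k)$ let $$V_n=\sum_{k=-n+1}^{n-1} w_n(k)\,\frac1n\sum_{j=\max(1,1-k)}^{\min(n-k,n)}(x_j-\bar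 x)(x_{j+k}-\bar x)$$ be the weighted empirical long-run variance of the squared increments. Consider the cusum process $$S_{n,m}=\frac{1}{D_n}\,\frac{1}{\sqrt n}\sum_{j=1}^m (x_j-\bar x),\quad 1\le m\le n,\qquad D_n=\begin{cases}\sqrt{V_n}, & V_n>0,\\ 1, & V_n\le 0,\end{cases}$$ so that no standardization takes place where $V_n$ is not positive (which, for $w_n\equiv1$, is always the case, since then $V_n=\frac1n\big(\sum_{j=1}^n(x_j-\bar x)\big)^2=0$). Let $\hat\theta_n=\Delta_n\hat m_n$, where $\hat m_n$ is any maximizer of $m\mapsto|S_{n,m}|$ over $1\le m\le n$. Then, for every choice of the weights and of the maximizers, $$|\hat\theta_n-\theta|=O_P\big(\log(n)\,n^{-1/2}\big)\qquad(n\to\infty),$$ that is, for every $\varepsilon>0$ there are $K>0$ and $n_0$ such that $P\big(|\hat\theta_n-\theta|>K\log(n)\,n^{-1/2}\big)<\varepsilon$ for all $n\ge n_0$. -/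

import Mathlib

open MeasureTheory ProbabilityTheory
open scoped NNReal

/-- `B = (B_t)_{t ≥ 0}` is a fractional Brownian motion with Hurst exponent `H` under `μ`:
a centered Gaussian process with (almost surely) continuous paths and covariance function
`(t ^ (2H) + s ^ (2H) - |t - s| ^ (2H)) / 2`. -/
structure IsFractionalBrownianMotion {Ω : Type*} [MeasurableSpace Ω]
    (H : ℝ) (B : ℝ≥0 → Ω → ℝ) (μ : Measure Ω) : Prop where
  gaussian : IsGaussianProcess B μ
  centered : ∀ t, ∫ ω, B t ω ∂μ = 0
  covariance : ∀ t s : ℝ≥0, ∫ ω, B t ω * B s ω ∂μ =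
    ((t : ℝ) ^ (2 * H) + (s : ℝ) ^ (2 * H) - |(t : ℝ) - (s : ℝ)| ^ (2 * H)) / 2
  continuous_paths : ∀ᵐ ω ∂μ, Continuous fun t => B t ω

/-- A single change of the Hurst exponent at time `θ`: the observed process `Z` on `[0, 1]` is
`σ B` on `[0, θ)`, with `B` a fractional Brownian motion with exponent `H`, and `ξ + σ B'` on
`[θ, 1]`, with `B'` a fractional Brownian motion with exponent `H'`. The joint law of `B` and `B'`
is arbitrary, and so is the random level `ξ` from which the process restarts at `θ`: `ξ = 0` gives
`σ B'` itself, and `ξ = σ (B_θ - B'_θ)` gives a continuous process. -/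
def IsHurstChange {Ω : Type*} [MeasurableSpace Ω] (μ : Measure Ω)
    (σ H H' θ : ℝ) (Z : ℝ≥0 → Ω → ℝ) : Prop :=
  ∃ (B B' : ℝ≥0 → Ω → ℝ) (ξ : Ω → ℝ),
    IsFractionalBrownianMotion H B μ ∧ IsFractionalBrownianMotion H' B' μ ∧
    ∀ t : ℝ≥0, t ≤ 1 → ∀ ω,
      ((t : ℝ) < θ → Z t ω = σ * B t ω) ∧ (θ ≤ (t : ℝ) → Z t ω = ξ ω + σ * B' t ω)

/-- The squared increment `(Z_{j/n} - Z_{(j-1)/n})²` of a path `z`, for `1 ≤ j ≤ n`. -/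
noncomputable def sqIncr (z : ℝ≥0 → ℝ) (n j : ℕ) : ℝ :=
  (z ((j : ℝ≥0) / n) - z (((j - 1 : ℕ) : ℝ≥0) / n)) ^ 2

/-- The mean of the `n` squared increments. -/
noncomputable def meanSqIncr (z : ℝ≥0 → ℝ) (n : ℕ) : ℝ :=
  (1 / (n : ℝ)) * ∑ j ∈ Finset.Icc 1 n, sqIncr z n j

/-- The empirical autocovariance of the squared increments at lag `k`, `-n < k < n`: the sum runs
over all `j` such that `j` and `j + k` are both in `{1, …, n}`. -/
noncomputable def autocovSqIncr (z : ℝ≥0 → ℝ) (n : ℕ) (k : ℤ) : ℝ :=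
  (1 / (n : ℝ)) * ∑ j ∈ Finset.Icc (max 1 (1 - k)) (min ((n : ℤ) - k) n),
    (sqIncr z n j.toNat - meanSqIncr z n) * (sqIncr z n (j + k).toNat - meanSqIncr z n)

/-- The empirical long-run variance of the squared increments: the sum of the empirical
autocovariances over all lags `-n < k < n`, with lag weights `w k` (`w = 1`: the plain sum). -/
noncomputable def longRunVar (w : ℤ → ℝ) (z : ℝ≥0 → ℝ) (n : ℕ) : ℝ :=
  ∑ k ∈ Finset.Icc (-(n : ℤ) + 1) ((n : ℤ) - 1), w k * autocovSqIncr z n k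

/-- The standardizing factor: the square root of the empirical long-run variance where that is
positive; elsewhere no standardization takes place. -/
noncomputable def standardizer (w : ℤ → ℝ) (z : ℝ≥0 → ℝ) (n : ℕ) : ℝ :=
  open scoped Classical in
  if 0 < longRunVar w z n then Real.sqrt (longRunVar w z n) else 1

/-- The standardized cusum process of squared increments `S_{n,m}`. -/
noncomputable def cusum (w : ℤ → ℝ) (z : ℝ≥0 → ℝ) (n m : ℕ) : ℝ :=
  ((1 / Real.sqrt n) * ∑ j ∈ Finset.Icc 1 m, (sqIncr z n j - meanSqIncr z n)) /
    standardizer w z n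

/-- `m` is a maximizer of `|S_{n,m}|` over `1 ≤ m ≤ n`. -/
def IsCusumArgmax (w : ℤ → ℝ) (z : ℝ≥0 → ℝ) (n m : ℕ) : Prop :=
  m ∈ Finset.Icc 1 n ∧ ∀ l ∈ Finset.Icc 1 n, |cusum w z n l| ≤ |cusum w z n m|

/-- `X_n = O_P(r_n)` as `n → ∞`: for every `ε > 0` there are `K` and `n₀` such that
`P(|X_n| > K |r_n|) < ε` for all `n ≥ n₀`. For sets that are not measurable, `μ` is the outer
measure. -/
def IsBigOInProbability {Ω : Type*} [MeasurableSpace Ω] (μ : Measure Ω)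
    (X : ℕ → Ω → ℝ) (r : ℕ → ℝ) : Prop :=
  ∀ ε : ℝ, 0 < ε → ∃ K : ℝ, 0 < K ∧ ∃ n₀ : ℕ, ∀ n ≥ n₀,
    μ {ω | K * |r n| < |X n ω|} < ENNReal.ofReal ε

/-! The standardizer is positive and does not depend on `m`, so only the partial sums `F` of the
squared increments matter. By self-similarity the squared increments have mean `σ² n^(-2H)` before
the change and `σ² n^(-2H')` after it. Since `H ≠ H'`, one slope is eventually negligible against
the other. The single increment straddling `θ` is arbitrary, because `ξ` is.

The deterministic core is `cusum_argmax_near`: if `F` has nearly these slopes on every stretch of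
length at least `D` that starts at the change and runs left or right, then the maximizer lies within
about `D` indices of the change. On the steep side the cusum moves towards its peak; on the flat
side it falls back by the mean drift. A huge straddling increment only moves the peak from one of
its ends to the other.

The probabilistic part finds a `D` independent of `n`. By Isserlis' formula the variance of a
centered sum of `d` scaled squared increments is `2 ∑ ρ²`. No decay of the correlations is needed:
off the diagonal they have a constant sign, so `∑ ρ²` is controlled by `∑ ρ`, which telescopes to
`d^(2H)`. This gives `O(d^β)` with `β = max 1 (2H) < 2`, and Chebyshev along a polynomial
subsequence, with monotone interpolation, gives near-linearity for all `d ≥ D` at once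
(`exists_forall_measure_exists_lt_abs_sum_le`). A union bound over the two sides works for any joint
law. The error obtained is `O_P(1/n)`, stronger than the stated rate. -/

/-! ### Gaussian fourth moments and the variance of sums of squares -/

theorem hasDerivAt_mul_exp_sq_div_two (v : ℝ) (P P' : ℝ → ℝ) (hP : ∀ t, HasDerivAt P (P' t) t)
    (t : ℝ) : HasDerivAt (fun t => P t * Real.exp (v * t ^ 2 / 2))
      ((P' t + v * t * P t) * Real.exp (v * t ^ 2 / 2)) t := by
  have h1 : HasDerivAt (fun t : ℝ => v * t ^ 2 / 2) (v * t) t := by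
    have := ((hasDerivAt_pow 2 t).const_mul v).div_const 2
    exact this.congr_deriv (by norm_num; ring)
  exact ((hP t).fun_mul h1.exp).congr_deriv (by ring)

/-- Differentiating `P t * exp (v t² / 2)` replaces `P` by `P' + v t P`; four rounds from `P = 1`
give the fourth moment, as this exponential is the Gaussian moment generating function. -/
theorem iteratedDeriv_four_exp_sq_div_two (v : ℝ) :
    iteratedDeriv 4 (fun t => Real.exp (v * t ^ 2 / 2)) 0 = 3 * v ^ 2 := by
  have step : ∀ P P' : ℝ → ℝ, (∀ t, HasDerivAt P (P' t) t) →
      deriv (fun t => P t * Real.exp (v * t ^ 2 / 2)) =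
        fun t => (P' t + v * t * P t) * Real.exp (v * t ^ 2 / 2) := fun P P' h =>
    funext fun t => (hasDerivAt_mul_exp_sq_div_two v P P' h t).deriv
  have e0 : (fun t => Real.exp (v * t ^ 2 / 2)) =
      fun t => (fun _ => (1 : ℝ)) t * Real.exp (v * t ^ 2 / 2) := by simp
  have hl : ∀ t : ℝ, HasDerivAt (fun t => v * t) v t := fun t => by
    simpa using (hasDerivAt_id t).const_mul v
  have hp : ∀ (k : ℕ) (c t : ℝ), HasDerivAt (fun t => c * t ^ (k + 1)) (c * ((k + 1) * t ^ k)) t :=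
    fun k c t => by simpa using (hasDerivAt_pow (k + 1) t).const_mul c
  rw [e0, iteratedDeriv_succ', step _ (fun _ => 0) (fun t => hasDerivAt_const _ _),
    iteratedDeriv_succ', step (fun t => 0 + v * t * 1) (fun _ => v) (by simpa using hl),
    iteratedDeriv_succ',
    step (fun t => v + v * t * (0 + v * t * 1)) (fun t => v ^ 2 * (2 * t)) (fun t => by
      have := (hp 1 (v ^ 2) t).const_add v
      convert! this using 1
      · funext s; ring
      · norm_num),
    iteratedDeriv_succ',
    step (fun t => v ^ 2 * (2 * t) + v * t * (v + v * t * (0 + v * t * 1)))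
      (fun t => 3 * v ^ 2 + v ^ 3 * (3 * t ^ 2)) (fun t => by
      have := (hp 0 (3 * v ^ 2) t).add (hp 2 (v ^ 3) t)
      convert! this using 1
      · funext s; simp; ring
      · norm_num)]
  simp

theorem integral_pow_four_gaussianReal_zero (v : ℝ≥0) :
    ∫ x, x ^ 4 ∂(gaussianReal 0 v) = 3 * (v : ℝ) ^ 2 := by
  have h := iteratedDeriv_mgf_zero (X := id) (μ := gaussianReal 0 v)
    (by simp [integrableExpSet_id_gaussianReal]) 4
  rw [mgf_id_gaussianReal] at h
  simp only [zero_mul, zero_add] at h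
  rw [iteratedDeriv_four_exp_sq_div_two] at h
  simpa using h.symm

section

variable {Ω : Type*} [MeasurableSpace Ω] {μ : Measure Ω}

theorem integrable_fun_sub {f g : Ω → ℝ} (hf : Integrable f μ) (hg : Integrable g μ) :
    Integrable (fun ω => f ω - g ω) μ := hf.sub hg

theorem ProbabilityTheory.HasGaussianLaw.integral_pow_four {X : Ω → ℝ} (hX : HasGaussianLaw X μ)
    (h0 : ∫ ω, X ω ∂μ = 0) : ∫ ω, X ω ^ 4 ∂μ = 3 * (∫ ω, X ω ^ 2 ∂μ) ^ 2 := by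
  have hv : Var[X; μ] = ∫ ω, X ω ^ 2 ∂μ := variance_of_integral_eq_zero hX.aemeasurable h0
  have hm := hX.map_eq_gaussianReal
  have h1 : ∫ ω, X ω ^ 4 ∂μ = ∫ x, x ^ 4 ∂(μ.map X) :=
    (integral_map (f := fun x : ℝ => x ^ 4) hX.aemeasurable (by fun_prop)).symm
  rw [h1, hm, h0, integral_pow_four_gaussianReal_zero, hv,
    Real.coe_toNNReal _ (integral_nonneg fun ω => sq_nonneg _)]

theorem ProbabilityTheory.HasGaussianLaw.integrable_pow {X : Ω → ℝ} (hX : HasGaussianLaw X μ)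
    (k : ℕ) :
    Integrable (fun ω => X ω ^ k) μ := by
  have := hX.isProbabilityMeasure
  rcases eq_or_ne k 0 with rfl | hk
  · simp
  rw [← integrable_norm_iff (hX.aemeasurable.pow_const k).aestronglyMeasurable]
  simpa using (hX.memLp (p := k) (by simp)).integrable_norm_pow hk

theorem integrable_mul_of_hasGaussianLaw {X Y : Ω → ℝ} (hX : HasGaussianLaw X μ)
    (hY : HasGaussianLaw Y μ) : Integrable (fun ω => X ω * Y ω) μ :=
  hX.memLp_two.integrable_mul hY.memLp_two

theorem integrable_sq_mul_sq_of_hasGaussianLaw {X Y : Ω → ℝ} (hX : HasGaussianLaw X μ)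
    (hY : HasGaussianLaw Y μ) : Integrable (fun ω => X ω ^ 2 * Y ω ^ 2) μ := by
  refine Integrable.mono' ((HasGaussianLaw.integrable_pow hX 4).add
    (HasGaussianLaw.integrable_pow hY 4))
    ((hX.aemeasurable.pow_const 2).mul (hY.aemeasurable.pow_const 2)).aestronglyMeasurable
    (ae_of_all _ fun ω => ?_)
  rw [Real.norm_eq_abs, abs_of_nonneg (by positivity)]
  simp only [Pi.add_apply]
  nlinarith [sq_nonneg (X ω ^ 2 - Y ω ^ 2), sq_nonneg (X ω ^ 2), sq_nonneg (Y ω ^ 2)]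

/-- Isserlis' formula for the squares of two centered jointly Gaussian variables. -/
theorem integral_sq_mul_sq_of_hasGaussianLaw {X Y : Ω → ℝ}
    (hXY : HasGaussianLaw (fun ω => (X ω, Y ω)) μ) (hX0 : ∫ ω, X ω ∂μ = 0)
    (hY0 : ∫ ω, Y ω ∂μ = 0) :
    ∫ ω, X ω ^ 2 * Y ω ^ 2 ∂μ =
      (∫ ω, X ω ^ 2 ∂μ) * (∫ ω, Y ω ^ 2 ∂μ) + 2 * (∫ ω, X ω * Y ω ∂μ) ^ 2 := by
  have hX := hXY.fst
  have hY := hXY.snd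
  have hA := hXY.fun_add
  have hS := hXY.fun_sub
  have hA4 := HasGaussianLaw.integral_pow_four hA
    (by rw [integral_add hX.integrable hY.integrable, hX0, hY0, add_zero])
  have hS4 := HasGaussianLaw.integral_pow_four hS
    (by rw [integral_sub hX.integrable hY.integrable, hX0, hY0, sub_zero])
  have hX4 := HasGaussianLaw.integral_pow_four hX hX0
  have hY4 := HasGaussianLaw.integral_pow_four hY hY0
  have iX := HasGaussianLaw.integrable_pow hX
  have iY := HasGaussianLaw.integrable_pow hY
  have iP := integrable_mul_of_hasGaussianLaw hX hY
  have iQ := integrable_sq_mul_sq_of_hasGaussianLaw hX hY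
  have hA2 : ∫ ω, (X ω + Y ω) ^ 2 ∂μ =
      ∫ ω, X ω ^ 2 ∂μ + 2 * ∫ ω, X ω * Y ω ∂μ + ∫ ω, Y ω ^ 2 ∂μ := by
    rw [← integral_const_mul, ← integral_add (iX 2) (iP.const_mul 2),
      ← integral_add ((iX 2).fun_add (iP.const_mul 2)) (iY 2)]
    exact integral_congr_ae (ae_of_all _ fun ω => by simp only []; ring)
  have hS2 : ∫ ω, (X ω - Y ω) ^ 2 ∂μ =
      ∫ ω, X ω ^ 2 ∂μ - 2 * ∫ ω, X ω * Y ω ∂μ + ∫ ω, Y ω ^ 2 ∂μ := by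
    rw [← integral_const_mul, ← integral_sub (iX 2) (iP.const_mul 2),
      ← integral_add (integrable_fun_sub (iX 2) (iP.const_mul 2)) (iY 2)]
    exact integral_congr_ae (ae_of_all _ fun ω => by simp only []; ring)
  -- Polarization: `X ± Y` are Gaussian too, so the mixed moment is the only term here not known
  -- from a variance.
  have h4 : ∫ ω, (X ω + Y ω) ^ 4 ∂μ + ∫ ω, (X ω - Y ω) ^ 4 ∂μ =
      2 * ∫ ω, X ω ^ 4 ∂μ + 12 * ∫ ω, X ω ^ 2 * Y ω ^ 2 ∂μ + 2 * ∫ ω, Y ω ^ 4 ∂μ := by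
    rw [← integral_add (HasGaussianLaw.integrable_pow hA 4) (HasGaussianLaw.integrable_pow hS 4),
      ← integral_const_mul, ← integral_const_mul, ← integral_const_mul,
      ← integral_add ((iX 4).const_mul 2) (iQ.const_mul 12),
      ← integral_add (((iX 4).const_mul 2).fun_add (iQ.const_mul 12)) ((iY 4).const_mul 2)]
    exact integral_congr_ae (ae_of_all _ fun ω => by simp only []; ring)
  rw [hA4, hS4, hX4, hY4, hA2, hS2] at h4
  linarith

/-- The centered sum of squares of standard jointly Gaussian variables has variance twice the sum
of their squared covariances. -/
theorem integral_sq_sum_sq_sub_one {X : ℕ → Ω → ℝ} (hX : IsGaussianProcess X μ)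
    (h0 : ∀ i, ∫ ω, X i ω ∂μ = 0) (s : Finset ℕ) (h1 : ∀ i ∈ s, ∫ ω, X i ω ^ 2 ∂μ = 1) :
    Integrable (fun ω => (∑ i ∈ s, (X i ω ^ 2 - 1)) ^ 2) μ ∧
    ∫ ω, (∑ i ∈ s, (X i ω ^ 2 - 1)) ^ 2 ∂μ =
      2 * ∑ i ∈ s, ∑ j ∈ s, (∫ ω, X i ω * X j ω ∂μ) ^ 2 := by
  have := hX.isProbabilityMeasure
  have hG := hX.hasGaussianLaw_eval
  have i2 := fun i => HasGaussianLaw.integrable_pow (hG i) 2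
  have i22 := fun i j => integrable_sq_mul_sq_of_hasGaussianLaw (hG i) (hG j)
  have hexp : ∀ ω, (∑ i ∈ s, (X i ω ^ 2 - 1)) ^ 2 =
      ∑ i ∈ s, ∑ j ∈ s, (X i ω ^ 2 * X j ω ^ 2 - X i ω ^ 2 - X j ω ^ 2 + 1) := fun ω => by
    rw [sq, Finset.sum_mul_sum]
    exact Finset.sum_congr rfl fun i _ => Finset.sum_congr rfl fun j _ => by ring
  have hint : ∀ i j, Integrable
      (fun ω => X i ω ^ 2 * X j ω ^ 2 - X i ω ^ 2 - X j ω ^ 2 + 1) μ := fun i j =>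
    (integrable_fun_sub (integrable_fun_sub (i22 i j) (i2 i)) (i2 j)).add (integrable_const 1)
  simp only [hexp]
  refine ⟨integrable_finsetSum _ fun i _ => integrable_finsetSum _ fun j _ => hint i j, ?_⟩
  rw [integral_finsetSum _ fun i _ => integrable_finsetSum _ fun j _ => hint i j, Finset.mul_sum]
  refine Finset.sum_congr rfl fun i hi => ?_
  rw [integral_finsetSum _ fun j _ => hint i j, Finset.mul_sum]
  refine Finset.sum_congr rfl fun j hj => ?_
  rw [integral_add (integrable_fun_sub (integrable_fun_sub (i22 i j) (i2 i)) (i2 j))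
      (integrable_const 1),
    integral_sub (integrable_fun_sub (i22 i j) (i2 i)) (i2 j), integral_sub (i22 i j) (i2 i),
    integral_sq_mul_sq_of_hasGaussianLaw hX.hasGaussianLaw_prodMk (h0 i) (h0 j), h1 i hi, h1 j hj]
  simp

end

/-! ### A quantitative strong law of large numbers -/

/-- Between consecutive `M`-th powers, a nondecreasing sequence close to the identity along the
`M`-th powers remains close to it. -/
theorem abs_sub_le_of_monotone_of_pow {W : ℕ → ℝ} (hW : Monotone W) {M k₀ : ℕ} (hM : M ≠ 0)
    {η : ℝ} (hη0 : 0 ≤ η) (hη1 : η ≤ 1)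
    (hratio : ∀ k ≥ k₀, ((k : ℝ) + 1) ^ M ≤ (1 + η) * (k : ℝ) ^ M)
    (h : ∀ k ≥ k₀, |W (k ^ M) - (k : ℝ) ^ M| ≤ η * (k : ℝ) ^ M) {d : ℕ} (hd : k₀ ^ M ≤ d) :
    |W d - d| ≤ 3 * η * d := by
  have hk₀d : k₀ ≤ d := (Nat.le_self_pow hM k₀).trans hd
  obtain ⟨k, hk₀, hkd, hdk⟩ : ∃ k, k₀ ≤ k ∧ k ^ M ≤ d ∧ d ≤ (k + 1) ^ M := by
    refine ⟨Nat.findGreatest (fun k => k ^ M ≤ d) d, Nat.le_findGreatest hk₀d hd,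
      Nat.findGreatest_spec (P := fun k => k ^ M ≤ d) hk₀d hd, ?_⟩
    set k := Nat.findGreatest (fun k => k ^ M ≤ d) d with hk
    by_cases hkd : k + 1 ≤ d
    · exact (not_le.1 (Nat.findGreatest_is_greatest (P := fun k => k ^ M ≤ d)
        (Nat.lt_succ_self k) hkd)).le
    · exact (not_le.1 hkd).le.trans (Nat.le_self_pow hM _)
  have h1 := abs_le.1 (h k hk₀)
  have h2 := abs_le.1 (h (k + 1) (by omega))
  have h3 := hratio k hk₀
  have h4 : (k : ℝ) ^ M ≤ d := by exact_mod_cast hkd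
  have h5 : (d : ℝ) ≤ ((k : ℝ) + 1) ^ M := by exact_mod_cast hdk
  have h6 := hW hkd
  have h7 := hW hdk
  have h8 : (0 : ℝ) ≤ (k : ℝ) ^ M := by positivity
  push_cast at h2
  have h9 : (1 + η) * ((k : ℝ) + 1) ^ M ≤ (1 + η) * ((1 + η) * (k : ℝ) ^ M) := by gcongr
  have h10 : η ^ 2 * (k : ℝ) ^ M ≤ η * (k : ℝ) ^ M := by
    gcongr
    nlinarith
  have h11 : η * (k : ℝ) ^ M ≤ η * d := by gcongr
  rw [abs_le]
  constructor <;> nlinarith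

theorem exists_forall_succ_pow_le (M : ℕ) {η : ℝ} (hη : 0 < η) :
    ∃ k₀ : ℕ, ∀ k ≥ k₀, ((k : ℝ) + 1) ^ M ≤ (1 + η) * (k : ℝ) ^ M := by
  have h : Filter.Tendsto (fun k : ℕ => (1 + 1 / (k : ℝ)) ^ M) Filter.atTop (nhds 1) := by
    simpa using (tendsto_one_div_atTop_nhds_zero_nat.const_add (1 : ℝ)).pow M
  obtain ⟨k₀, hk₀⟩ := Filter.eventually_atTop.1
    (h.eventually (eventually_le_nhds (show (1 : ℝ) < 1 + η by linarith)))
  refine ⟨max k₀ 1, fun k hk => ?_⟩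
  have hk1 : (0 : ℝ) < k := by exact_mod_cast (le_max_right k₀ 1).trans hk
  calc ((k : ℝ) + 1) ^ M = (1 + 1 / (k : ℝ)) ^ M * (k : ℝ) ^ M := by
        rw [← mul_pow]; congr 1; field_simp
    _ ≤ _ := by gcongr; exact hk₀ k ((le_max_left k₀ 1).trans hk)

section

variable {Ω : Type*} [MeasurableSpace Ω]

theorem measure_lt_abs_le_of_integral_sq_le (μ : Measure Ω) [IsFiniteMeasure μ] {X : Ω → ℝ}
    (hX : Integrable (fun ω => X ω ^ 2) μ) {t V : ℝ} (ht : 0 < t)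
    (hV : ∫ ω, X ω ^ 2 ∂μ ≤ V) : μ {ω | t < |X ω|} ≤ ENNReal.ofReal (V / t ^ 2) := by
  have h := mul_meas_ge_le_integral_of_nonneg (ae_of_all μ fun ω => sq_nonneg (X ω)) hX (t ^ 2)
  have hsub : {ω | t < |X ω|} ⊆ {ω | t ^ 2 ≤ X ω ^ 2} := fun ω (hω : t < |X ω|) => by
    rw [Set.mem_ofPred_eq, ← sq_abs (X ω)]
    gcongr
  refine (measure_mono hsub).trans ?_
  rw [← ofReal_measureReal]
  refine ENNReal.ofReal_le_ofReal ?_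
  rw [le_div_iff₀ (by positivity)]
  linarith

/-- A quantitative strong law: for nonnegative variables whose partial sums have variance
`O(d ^ β)`, `β < 2`, the partial sums are uniformly close to their means from some `D` on, with `D`
depending only on the constants. -/
theorem exists_forall_measure_exists_lt_abs_sum_le (μ : Measure Ω) [IsFiniteMeasure μ]
    {C β δ ε : ℝ} (hC : 0 ≤ C) (hβ : β < 2) (hδ : 0 < δ) (hε : 0 < ε) :
    ∃ D : ℕ, 1 ≤ D ∧ ∀ y : ℕ → Ω → ℝ, (∀ i ω, 0 ≤ y i ω) →
      (∀ d : ℕ, Integrable (fun ω => (∑ i ∈ Finset.range d, (y i ω - 1)) ^ 2) μ) →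
      (∀ d : ℕ, ∫ ω, (∑ i ∈ Finset.range d, (y i ω - 1)) ^ 2 ∂μ ≤ C * (d : ℝ) ^ β) →
      μ {ω | ∃ d ≥ D, δ * d < |∑ i ∈ Finset.range d, (y i ω - 1)|} ≤ ENNReal.ofReal ε := by
  -- Along `d = k ^ M` Chebyshev leaves `k ^ (-M (2 - β)) ≤ k ^ (-2)`, which is summable.
  obtain ⟨M, hM⟩ := exists_nat_ge (2 / (2 - β))
  have hM2 : 2 ≤ M * (2 - β) := by rwa [div_le_iff₀ (by linarith)] at hM
  have hM0 : M ≠ 0 := by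
    rintro rfl
    norm_num at hM2
  -- Interpolating between `M`-th powers triples the relative error and needs `η ≤ 1`.
  set η : ℝ := min δ 1 / 3 with hη
  have hmin : 0 < min δ 1 := lt_min hδ one_pos
  have hη0 : 0 < η := by positivity
  have hη1 : η ≤ 1 := by linarith [min_le_right δ 1]
  have hηδ : 3 * η ≤ δ := by linarith [min_le_left δ 1]
  obtain ⟨k₁, hk₁⟩ := exists_forall_succ_pow_le M hη0
  have hsum : Summable fun k : ℕ => C / η ^ 2 * (1 / (k : ℝ) ^ 2) :=
    (Real.summable_one_div_nat_pow.2 one_lt_two).mul_left _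
  obtain ⟨k₂, hk₂⟩ := Filter.eventually_atTop.1
    ((tendsto_sum_nat_add fun k : ℕ => C / η ^ 2 * (1 / (k : ℝ) ^ 2)).eventually
      (eventually_le_nhds hε))
  set k₀ := max (max k₁ k₂) 1 with hk₀
  have hk₀1 : 1 ≤ k₀ := le_max_right _ _
  refine ⟨k₀ ^ M, Nat.one_le_pow _ _ hk₀1, fun y hy hint hvar => ?_⟩
  have hsub : {ω | ∃ d ≥ k₀ ^ M, δ * d < |∑ i ∈ Finset.range d, (y i ω - 1)|} ⊆
      ⋃ j : ℕ, {ω | η * ((j + k₀ : ℕ) : ℝ) ^ M <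
        |∑ i ∈ Finset.range ((j + k₀) ^ M), (y i ω - 1)|} := by
    rintro ω ⟨d, hd, hlt⟩
    by_contra hω
    simp only [Set.mem_iUnion, Set.mem_ofPred_eq, not_exists, not_lt] at hω
    have hmono : Monotone fun d => ∑ i ∈ Finset.range d, y i ω := fun d e hde =>
      Finset.sum_le_sum_of_subset_of_nonneg (Finset.range_mono hde) fun i _ _ => hy i ω
    have hle := abs_sub_le_of_monotone_of_pow hmono hM0 hη0.le hη1
      (fun k hk => hk₁ k (le_trans (by simp [hk₀]) hk)) (k₀ := k₀) (fun k hk => by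
        have := hω (k - k₀)
        rw [Nat.sub_add_cancel hk] at this
        simpa using this) hd
    have h1 : 3 * η * (d : ℝ) ≤ δ * d := by gcongr
    simp only [Finset.sum_sub_distrib, Finset.sum_const, Finset.card_range, nsmul_eq_mul,
      mul_one] at hlt
    linarith
  have hpt : ∀ j : ℕ, μ {ω | η * ((j + k₀ : ℕ) : ℝ) ^ M <
      |∑ i ∈ Finset.range ((j + k₀) ^ M), (y i ω - 1)|} ≤
        ENNReal.ofReal (C / η ^ 2 * (1 / ((j + k₀ : ℕ) : ℝ) ^ 2)) := fun j => by
    have hpos : (1 : ℝ) ≤ ((j + k₀ : ℕ) : ℝ) := by exact_mod_cast hk₀1.trans (Nat.le_add_left _ _)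
    have hpos0 : (0 : ℝ) < ((j + k₀ : ℕ) : ℝ) := by linarith
    refine (measure_lt_abs_le_of_integral_sq_le μ (hint _) (by positivity) (hvar _)).trans
      (ENNReal.ofReal_le_ofReal ?_)
    set x : ℝ := ((j + k₀ : ℕ) : ℝ) with hx
    have h1 : (((j + k₀) ^ M : ℕ) : ℝ) ^ β = x ^ (M * β) := by
      rw [Nat.cast_pow, ← hx, ← Real.rpow_natCast, ← Real.rpow_mul hpos0.le]
    have h2 : x ^ ((M : ℝ) * β) * x ^ 2 ≤ x ^ M * x ^ M := by
      rw [← Real.rpow_natCast, ← Real.rpow_natCast, ← Real.rpow_add hpos0, ← Real.rpow_add hpos0]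
      refine Real.rpow_le_rpow_of_exponent_le hpos ?_
      push_cast
      linarith
    rw [h1, div_le_iff₀ (by positivity)]
    have h3 : C / η ^ 2 * (1 / x ^ 2) * (η * x ^ M) ^ 2 = C * ((x ^ M * x ^ M) / x ^ 2) := by
      field_simp
    rw [h3]
    gcongr
    rwa [le_div_iff₀ (by positivity)]
  calc _ ≤ _ := measure_mono hsub
    _ ≤ ∑' j : ℕ, ENNReal.ofReal (C / η ^ 2 * (1 / ((j + k₀ : ℕ) : ℝ) ^ 2)) :=
      (measure_iUnion_le _).trans (ENNReal.tsum_le_tsum hpt)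
    _ = ENNReal.ofReal (∑' j : ℕ, C / η ^ 2 * (1 / ((j + k₀ : ℕ) : ℝ) ^ 2)) :=
      (ENNReal.ofReal_tsum_of_nonneg (fun j => by positivity)
        ((summable_nat_add_iff k₀).2 hsum)).symm
    _ ≤ ENNReal.ofReal ε := ENNReal.ofReal_le_ofReal (hk₂ k₀ (by simp [hk₀]))

end

/-! ### The deterministic cusum argument -/

/-- Left of the change: a cusum with nearly unit slope cannot exceed both cusums at the change. -/
theorem abs_cusum_lt_of_left {c q i d r n S f X S' : ℝ} (hc0 : 0 < c) (hc1 : c ≤ 1) (hn : 0 < n)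
    (hi : 0 ≤ i) (hd : 0 < d) (hid : i + d = q) (hq : q ≤ n) (hr : c * n ≤ r)
    (hS : |S - q| ≤ c ^ 2 / 32 * q) (hf : |S - f - d| ≤ c ^ 2 / 32 * d)
    (hS' : S' ≤ c ^ 2 / 16 * r) :
    |f - i * X| < |S - q * X| ∨ |f - i * X| < |r * X - S'| := by
  by_contra! hcon
  obtain ⟨h1, h2⟩ := hcon
  have hδ : c ^ 2 ≤ c := by nlinarith
  have hr0 : 0 < r := by nlinarith
  have hq0 : 0 < q := by linarith
  have hiq : i ≤ q := by linarith
  obtain ⟨hS1, hS2⟩ := abs_le.1 hS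
  obtain ⟨hf1, hf2⟩ := abs_le.1 hf
  have hcq : c ^ 2 * q ≤ c * q := by gcongr
  have hcd : c ^ 2 * d ≤ c * d := by gcongr
  have hcr : c ^ 2 * r ≤ r := by nlinarith
  have hcqn : c * q ≤ c * n := by gcongr
  have hcin : c * i ≤ c * n := by gcongr; linarith
  have hcdn : c * d ≤ c * n := by gcongr; linarith
  have hcd0 : 0 < c * d := by positivity
  have hcq0 : 0 < c * q := by positivity
  have hci0 : 0 ≤ c * i := by positivity
  have hcn0 : 0 < c * n := by positivity
  -- If the mean slope `X` is clearly below 1, the cusum still climbs up to `q`. Otherwise the drift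
  -- over the nearly flat right part forces a cusum of at least `c n / 2` just after the change.
  rcases le_or_gt X (1 - c / 4) with hX | hX
  · have hiX : i * X ≤ i * (1 - c / 4) := by gcongr
    have hdX : d * X ≤ d * (1 - c / 4) := by gcongr
    have h3 : f - i * X < S - q * X := by rw [← hid]; nlinarith
    have h4 : -(f - i * X) < S - q * X := by rw [← hid]; nlinarith
    exact absurd (abs_lt.2 ⟨by linarith, h3⟩) (not_lt.2 ((le_abs_self _).trans h1))
  · have hiX : i * (1 - c / 4) ≤ i * X := by gcongr
    have hrX : r * (1 - c / 4) ≤ r * X := by gcongr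
    have hcr' : c * r ≤ r := by nlinarith
    have h3 : c * n / 2 ≤ r * X - S' := by linarith
    have h4 : f - i * X < c * n / 2 := by linarith
    have h5 : c * n / 2 ≤ |f - i * X| := h3.trans ((le_abs_self _).trans h2)
    rcases le_or_gt 0 (f - i * X) with h0 | h0
    · rw [abs_of_nonneg h0] at h5
      linarith
    -- A negative cusum at `i` that is at least as large in modulus as the one at `q` bounds `X` by
    -- nearly 1, and then its modulus is too small.
    · rw [abs_of_neg h0] at h1 h5
      have h6 : f - i * X ≤ S - q * X := by linarith [(neg_le_abs (S - q * X)).trans h1]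
      have h7 : d * X ≤ d * (1 + c ^ 2 / 32) := by rw [← hid] at h6; linarith
      have h8 : X ≤ 1 + c ^ 2 / 32 := le_of_mul_le_mul_left h7 hd
      have h9 : i * X ≤ i * (1 + c ^ 2 / 32) := by gcongr
      have h10 : c ^ 2 * i ≤ c * i := by gcongr
      linarith

/-- Right of the change: a cusum with small slope stays below the cusum at the change. -/
theorem abs_cusum_lt_of_right {c d r X V S' : ℝ} (hc0 : 0 < c) (hc1 : c ≤ 1)
    (hd : 0 < d) (hdr : d ≤ r) (hX : c / 2 ≤ X)
    (hV0 : 0 ≤ V) (hV : V ≤ c ^ 2 / 16 * d) (hS' : S' ≤ c ^ 2 / 16 * r) :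
    |r * X - S' + (V - d * X)| < |r * X - S'| := by
  have hδ : c ^ 2 ≤ c := by nlinarith
  have hr0 : 0 < r := by linarith
  have h1 : d * (c / 2) ≤ d * X := by gcongr
  have h2 : r * (c / 2) ≤ r * X := by gcongr
  have h3 : c ^ 2 * d ≤ c * d := by gcongr
  have h4 : c ^ 2 * r ≤ c * r := by gcongr
  have h5 : d * X ≤ r * X := by gcongr; linarith
  have h6 : 0 < c * d := by positivity
  have h7 : 0 < c * r := by positivity
  have h8 : 0 < r * X - S' := by linarith
  rw [abs_of_pos h8, abs_lt]
  constructor <;> linarith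

/-- Both `q` and `q + 1` have to serve as competitors, since nothing is known about the increment
between them. Here the left slope is normalized to 1. -/
theorem cusum_argmax_near_of_left_dominant {F : ℕ → ℝ} {q r D m : ℕ} {c : ℝ} (hF : Monotone F)
    (hF0 : F 0 = 0) (hc0 : 0 < c) (hc1 : c ≤ 1) (hq : c * ((q + 1 + r : ℕ) : ℝ) ≤ q)
    (hr : c * ((q + 1 + r : ℕ) : ℝ) ≤ r) (hD : 1 ≤ D) (hDq : D ≤ q) (hDr : D ≤ r)
    (hleft : ∀ i d : ℕ, i + d = q → D ≤ d → |F q - F i - d| ≤ c ^ 2 / 32 * d)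
    (hright : ∀ d : ℕ, d ≤ r → D ≤ d → F (q + 1 + d) - F (q + 1) ≤ c ^ 2 / 16 * d)
    (hm : m ≤ q + 1 + r)
    (hmax : ∀ l ≤ q + 1 + r,
      |F l - l * (F (q + 1 + r) / (q + 1 + r : ℕ))| ≤
        |F m - m * (F (q + 1 + r) / (q + 1 + r : ℕ))|) :
    q < m + D ∧ m < q + 1 + D := by
  set n := q + 1 + r with hn
  set X := F n / (n : ℝ) with hX
  have hn0 : (0 : ℝ) < n := by rw [hn]; positivity
  have hnX : F n = n * X := by rw [hX]; field_simp
  have hnr : (n : ℝ) = q + 1 + r := by rw [hn]; push_cast; ring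
  have hq' : |F q - q| ≤ c ^ 2 / 32 * q := by simpa [hF0] using hleft 0 q (zero_add q) hDq
  have hr' := hright r le_rfl hDr
  rw [← hn] at hr'
  -- The cusum vanishes at `n`, so its value at `q + 1` can be read off from the right part alone.
  have hTq : F (q + 1) - ((q + 1 : ℕ) : ℝ) * X = r * X - (F n - F (q + 1)) := by
    rw [hnX, hnr]; push_cast; ring
  constructor
  · by_contra! hcon
    obtain ⟨d, hd⟩ : ∃ d, m + d = q := ⟨q - m, by omega⟩
    have hDd : D ≤ d := by omega
    have h := abs_cusum_lt_of_left (X := X) hc0 hc1 hn0 (Nat.cast_nonneg m)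
      (show (0 : ℝ) < (d : ℝ) by exact_mod_cast hD.trans hDd) (by exact_mod_cast hd)
      (show (q : ℝ) ≤ n by exact_mod_cast (show q ≤ n by omega)) hr hq' (hleft m d hd hDd) hr'
    rcases h with h | h
    · exact absurd (hmax q (by omega)) (not_le.2 h)
    · rw [← hTq] at h
      exact absurd (hmax (q + 1) (by omega)) (not_le.2 h)
  · by_contra! hcon
    obtain ⟨d, hd⟩ : ∃ d, m = q + 1 + d := ⟨m - (q + 1), by omega⟩
    have hDd : D ≤ d := by omega
    -- The left part alone already lifts the overall mean this far.
    have hXc : c / 2 ≤ X := by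
      rw [hX, le_div_iff₀ hn0]
      have h1 : F q ≤ F n := hF (by omega)
      have h2 := (abs_le.1 hq').1
      have h3 : c ^ 2 * q ≤ 1 * q := by gcongr; nlinarith
      linarith
    have h := abs_cusum_lt_of_right (X := X) (V := F (q + 1 + d) - F (q + 1)) hc0 hc1
      (show (0 : ℝ) < (d : ℝ) by exact_mod_cast hD.trans hDd)
      (show (d : ℝ) ≤ r by exact_mod_cast (show d ≤ r by omega)) hXc
      (by linarith [hF (show q + 1 ≤ q + 1 + d by omega)]) (hright d (by omega) hDd) hr'
    refine absurd (hmax (q + 1) (by omega)) (not_le.2 ?_)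
    rw [hTq]
    have hTm : F m - m * X = r * X - (F n - F (q + 1)) + (F (q + 1 + d) - F (q + 1) - d * X) := by
      rw [hnX, hnr, hd]; push_cast; ring
    rwa [hTm]

/-- The maximizer of the cusum process is close to the change point as soon as the partial sums `F`
are nearly linear on either side of it, whatever the increment at the change point, provided that
one of the slopes is much smaller than the other. -/
theorem cusum_argmax_near {F : ℕ → ℝ} {q r D m : ℕ} {a b c : ℝ} (hF : Monotone F)
    (hF0 : F 0 = 0) (ha : 0 < a) (hb : 0 < b) (hc0 : 0 < c) (hc1 : c ≤ 1)
    (hab : b ≤ c ^ 2 / 32 * a ∨ a ≤ c ^ 2 / 32 * b)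
    (hq : c * ((q + 1 + r : ℕ) : ℝ) ≤ q)
    (hr : c * ((q + 1 + r : ℕ) : ℝ) ≤ r) (hD : 1 ≤ D) (hDq : D ≤ q) (hDr : D ≤ r)
    (hleft : ∀ i d : ℕ, i + d = q → D ≤ d → |F q - F i - a * d| ≤ c ^ 2 / 32 * (a * d))
    (hright : ∀ d : ℕ, d ≤ r → D ≤ d →
      |F (q + 1 + d) - F (q + 1) - b * d| ≤ c ^ 2 / 32 * (b * d))
    (hm : m ≤ q + 1 + r)
    (hmax : ∀ l ≤ q + 1 + r,
      |F l - l * (F (q + 1 + r) / (q + 1 + r : ℕ))| ≤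
        |F m - m * (F (q + 1 + r) / (q + 1 + r : ℕ))|) :
    q < m + D ∧ m < q + 1 + D := by
  have hc2 : c ^ 2 ≤ 1 := by nlinarith
  -- A relative error of at most 1 doubles the small slope, whence `c² / 16` from `c² / 32`.
  have key : ∀ u v t : ℝ, 0 < u → v ≤ c ^ 2 / 32 * u → ∀ d : ℕ,
      |t - v * d| ≤ c ^ 2 / 32 * (v * d) → t / u ≤ c ^ 2 / 16 * d := fun u v t hu hvu d h => by
    have h1 := (abs_le.1 h).2
    have h2 : v * d ≤ c ^ 2 / 32 * u * d := by gcongr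
    have h3 : 0 ≤ v * d := by
      have := (abs_nonneg _).trans h
      by_contra! hneg
      nlinarith [sq_nonneg c, pow_pos hc0 2]
    rw [div_le_iff₀ hu]
    have h4 : c ^ 2 / 32 * (v * d) ≤ 1 * (v * d) := by gcongr; linarith
    linarith
  have key' : ∀ u t : ℝ, 0 < u → ∀ d : ℕ, |t - u * d| ≤ c ^ 2 / 32 * (u * d) →
      |t / u - d| ≤ c ^ 2 / 32 * d := fun u t hu d h => by
    have : t / u - d = (t - u * d) / u := by field_simp
    rw [this, abs_div, abs_of_pos hu, div_le_iff₀ hu]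
    linarith
  rcases hab with hab | hab
  · refine cusum_argmax_near_of_left_dominant (F := fun l => F l / a) (fun k l h => by
      have := hF h
      simp only []
      gcongr) (by simp [hF0]) hc0 hc1 hq hr hD hDq hDr
      (fun i d hid hd => ?_) (fun d hdr hd => ?_) hm (fun l hl => ?_)
    · rw [← sub_div]
      exact key' a _ ha d (hleft i d hid hd)
    · rw [← sub_div]
      exact key a b _ ha hab d (hright d hdr hd)
    · have : ∀ k : ℕ, F k / a - k * (F (q + 1 + r) / a / (q + 1 + r : ℕ)) =
          (F k - k * (F (q + 1 + r) / (q + 1 + r : ℕ))) / a := fun k => by ring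
      rw [this, this, abs_div, abs_div]
      exact div_le_div_of_nonneg_right (hmax l hl) (abs_nonneg a)
  -- Time reversal exchanges `q` and `r`, keeps the straddling increment in place and only flips the
  -- sign of the cusum.
  · have hn : r + 1 + q = q + 1 + r := by ring
    have h := cusum_argmax_near_of_left_dominant (q := r) (r := q) (D := D) (m := q + 1 + r - m)
      (F := fun l => (F (q + 1 + r) - F (q + 1 + r - l)) / b) (fun k l h => by
        have := hF (show q + 1 + r - l ≤ q + 1 + r - k by omega)
        simp only []
        gcongr) (by simp) hc0 hc1 (by rwa [hn]) (by rwa [hn]) hD hDr hDq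
      (fun i d hid hd => ?_) (fun d hdr hd => ?_) (by omega) (fun l hl => ?_)
    · omega
    · have := key' b _ hb d (hright d (by omega) hd)
      convert! this using 2
      rw [show q + 1 + r - r = q + 1 by omega, show q + 1 + r - i = q + 1 + d by omega]
      ring
    · have := key b a _ hb hab d (hleft (q - d) d (by omega) hd)
      convert! this using 1
      rw [show q + 1 + r - (r + 1 + d) = q - d by omega, show q + 1 + r - (r + 1) = q by omega]
      ring
    · have : ∀ k ≤ q + 1 + r, (F (q + 1 + r) - F (q + 1 + r - k)) / b -
          k * ((F (q + 1 + r) - F (q + 1 + r - (r + 1 + q))) / b / (r + 1 + q : ℕ)) =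
          -((F (q + 1 + r - k) -
            (q + 1 + r - k : ℕ) * (F (q + 1 + r) / (q + 1 + r : ℕ))) / b) := fun k hk => by
        have hnn : ((q + 1 + r : ℕ) : ℝ) ≠ 0 := by positivity
        rw [hn, Nat.sub_self, hF0, Nat.cast_sub hk]
        field_simp
        ring
      rw [this l (by omega), this _ (by omega), abs_neg, abs_neg, abs_div, abs_div]
      rw [show q + 1 + r - (q + 1 + r - m) = m by omega]
      exact div_le_div_of_nonneg_right (hmax _ (by omega)) (abs_nonneg b)

/-! ### Signs of correlations and their squared sums -/

/-- Midpoint convexity; `1 ≤ |x|` keeps both neighbours on one side of the origin. With `p = 2H` it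
yields nonnegative correlations of distinct increments. -/
theorem two_mul_rpow_le_of_one_le_abs {p : ℝ} (hp : 1 ≤ p) {x : ℝ} (hx : 1 ≤ |x|) :
    2 * |x| ^ p ≤ |x + 1| ^ p + |x - 1| ^ p := by
  have h : ∀ y : ℝ, 1 ≤ y → 2 * y ^ p ≤ (y + 1) ^ p + (y - 1) ^ p := fun y hy => by
    have := (convexOn_rpow hp).2 (show y + 1 ∈ Set.Ici (0 : ℝ) from by simp; linarith)
      (show y - 1 ∈ Set.Ici (0 : ℝ) by simpa using hy) (show (0 : ℝ) ≤ 1 / 2 by norm_num)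
      (show (0 : ℝ) ≤ 1 / 2 by norm_num) (by norm_num)
    simp only [smul_eq_mul] at this
    rw [show 1 / 2 * (y + 1) + 1 / 2 * (y - 1) = y by ring] at this
    linarith
  rcases le_abs'.1 hx with hx' | hx'
  · rw [abs_of_nonpos (by linarith : x ≤ 0), abs_of_nonpos (by linarith : x + 1 ≤ 0),
      abs_of_nonpos (by linarith : x - 1 ≤ 0)]
    have := h (-x) (by linarith)
    rw [show -(x + 1) = -x - 1 by ring, show -(x - 1) = -x + 1 by ring]
    linarith
  · rw [abs_of_nonneg (by linarith : 0 ≤ x), abs_of_nonneg (by linarith : 0 ≤ x + 1),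
      abs_of_nonneg (by linarith : 0 ≤ x - 1)]
    exact h x hx'

theorem rpow_add_rpow_le_of_one_le_abs {p : ℝ} (hp0 : 0 ≤ p) (hp : p ≤ 1) {x : ℝ}
    (hx : 1 ≤ |x|) : |x + 1| ^ p + |x - 1| ^ p ≤ 2 * |x| ^ p := by
  have h : ∀ y : ℝ, 1 ≤ y → (y + 1) ^ p + (y - 1) ^ p ≤ 2 * y ^ p := fun y hy => by
    have := (Real.concaveOn_rpow hp0 hp).2 (show y + 1 ∈ Set.Ici (0 : ℝ) from by simp; linarith)
      (show y - 1 ∈ Set.Ici (0 : ℝ) by simpa using hy) (show (0 : ℝ) ≤ 1 / 2 by norm_num)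
      (show (0 : ℝ) ≤ 1 / 2 by norm_num) (by norm_num)
    simp only [smul_eq_mul] at this
    rw [show 1 / 2 * (y + 1) + 1 / 2 * (y - 1) = y by ring] at this
    linarith
  rcases le_abs'.1 hx with hx' | hx'
  · rw [abs_of_nonpos (by linarith : x ≤ 0), abs_of_nonpos (by linarith : x + 1 ≤ 0),
      abs_of_nonpos (by linarith : x - 1 ≤ 0)]
    have := h (-x) (by linarith)
    rw [show -(x + 1) = -x - 1 by ring, show -(x - 1) = -x + 1 by ring]
    linarith
  · rw [abs_of_nonneg (by linarith : 0 ≤ x), abs_of_nonneg (by linarith : 0 ≤ x + 1),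
      abs_of_nonneg (by linarith : 0 ≤ x - 1)]
    exact h x hx'

/-- A correlation matrix whose off-diagonal entries have constant sign has small squared Frobenius
norm if the sum of its entries is small. -/
theorem sum_sq_le_of_nonneg {ι : Type*} {ρ : ι → ι → ℝ} (s : Finset ι)
    (h1 : ∀ i ∈ s, ∀ j ∈ s, |ρ i j| ≤ 1) (h : ∀ i ∈ s, ∀ j ∈ s, 0 ≤ ρ i j) :
    ∑ i ∈ s, ∑ j ∈ s, ρ i j ^ 2 ≤ ∑ i ∈ s, ∑ j ∈ s, ρ i j :=
  Finset.sum_le_sum fun i hi => Finset.sum_le_sum fun j hj => by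
    nlinarith [h i hi j hj, (abs_le.1 (h1 i hi j hj)).2]

theorem sum_sq_le_of_nonpos {ι : Type*} [DecidableEq ι] {ρ : ι → ι → ℝ} (s : Finset ι)
    (h1 : ∀ i ∈ s, ∀ j ∈ s, |ρ i j| ≤ 1) (hdiag : ∀ i ∈ s, ρ i i = 1)
    (h : ∀ i ∈ s, ∀ j ∈ s, i ≠ j → ρ i j ≤ 0) :
    ∑ i ∈ s, ∑ j ∈ s, ρ i j ^ 2 ≤ 2 * s.card - ∑ i ∈ s, ∑ j ∈ s, ρ i j := by
  -- Off the diagonal `ρ² ≤ -ρ` as `-1 ≤ ρ ≤ 0`; on it the correction 2 makes up for `ρ = 1`.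
  have key : ∀ i ∈ s, ∀ j ∈ s, ρ i j ^ 2 ≤ (if i = j then 2 else 0) - ρ i j :=
    fun i hi j hj => by
      split_ifs with hij
      · subst hij
        rw [hdiag i hi]
        norm_num
      · nlinarith [h i hi j hj hij, (abs_le.1 (h1 i hi j hj)).1]
  refine (Finset.sum_le_sum fun i hi => Finset.sum_le_sum fun j hj => key i hi j hj).trans
    (le_of_eq ?_)
  simp only [Finset.sum_sub_distrib]
  congr 1
  rw [Finset.sum_congr rfl fun i hi => by rw [Finset.sum_ite_eq s i, if_pos hi]]
  simp [mul_comm]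

/-! ### Scaled increments of fractional Brownian motion -/

/-- The increments of `B` over the grid of mesh `1 / n`, scaled to unit variance for a fractional
Brownian motion of Hurst exponent `H`. -/
noncomputable def scaledIncr {Ω : Type*} (H : ℝ) (B : ℝ≥0 → Ω → ℝ) (n i : ℕ) (ω : Ω) : ℝ :=
  (n : ℝ) ^ H * (B (((i + 1 : ℕ) : ℝ≥0) / n) ω - B ((i : ℝ≥0) / n) ω)

namespace IsFractionalBrownianMotion

variable {Ω : Type*} [MeasurableSpace Ω] {μ : Measure Ω} {H : ℝ} {B : ℝ≥0 → Ω → ℝ}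

theorem integral_incr_mul_incr (hB : IsFractionalBrownianMotion H B μ) (s t u v : ℝ≥0) :
    ∫ ω, (B t ω - B s ω) * (B v ω - B u ω) ∂μ =
      (|(t : ℝ) - u| ^ (2 * H) + |(s : ℝ) - v| ^ (2 * H)
        - |(t : ℝ) - v| ^ (2 * H) - |(s : ℝ) - u| ^ (2 * H)) / 2 := by
  have hi : ∀ a b, Integrable (fun ω => B a ω * B b ω) μ := fun a b =>
    integrable_mul_of_hasGaussianLaw (hB.gaussian.hasGaussianLaw_eval a)
      (hB.gaussian.hasGaussianLaw_eval b)
  have he : ∀ ω, (B t ω - B s ω) * (B v ω - B u ω) =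
      B t ω * B v ω - B t ω * B u ω - (B s ω * B v ω - B s ω * B u ω) := fun ω => by ring
  simp only [he]
  rw [integral_sub (integrable_fun_sub (hi t v) (hi t u))
    (integrable_fun_sub (hi s v) (hi s u)), integral_sub (hi t v) (hi t u),
    integral_sub (hi s v) (hi s u)]
  simp only [hB.covariance]
  ring

theorem isGaussianProcess_scaledIncr (hB : IsFractionalBrownianMotion H B μ) (n : ℕ) :
    IsGaussianProcess (scaledIncr H B n) μ := by
  classical
  exact hB.gaussian.of_isGaussianProcess fun i =>
    ⟨{((i + 1 : ℕ) : ℝ≥0) / n, (i : ℝ≥0) / n},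
      (n : ℝ) ^ H • (ContinuousLinearMap.proj ⟨((i + 1 : ℕ) : ℝ≥0) / n, by simp⟩ -
        ContinuousLinearMap.proj ⟨(i : ℝ≥0) / n, by simp⟩), fun ω => by
      simp [scaledIncr]⟩

theorem integral_scaledIncr (hB : IsFractionalBrownianMotion H B μ) (n i : ℕ) :
    ∫ ω, scaledIncr H B n i ω ∂μ = 0 := by
  have hi := fun t => (hB.gaussian.hasGaussianLaw_eval t).integrable
  simp only [scaledIncr]
  rw [integral_const_mul, integral_sub (hi _) (hi _), hB.centered, hB.centered]
  simp

theorem integral_scaled_incr_mul_incr (hB : IsFractionalBrownianMotion H B μ) {n : ℕ}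
    (hn : n ≠ 0) (i i' j j' : ℕ) :
    ∫ ω, ((n : ℝ) ^ H * (B ((i' : ℝ≥0) / n) ω - B ((i : ℝ≥0) / n) ω)) *
        ((n : ℝ) ^ H * (B ((j' : ℝ≥0) / n) ω - B ((j : ℝ≥0) / n) ω)) ∂μ =
      (|(i' : ℝ) - j| ^ (2 * H) + |(i : ℝ) - j'| ^ (2 * H)
        - |(i' : ℝ) - j'| ^ (2 * H) - |(i : ℝ) - j| ^ (2 * H)) / 2 := by
  have hn0 : (0 : ℝ) < n := by positivity
  have he : ∀ ω, ((n : ℝ) ^ H * (B ((i' : ℝ≥0) / n) ω - B ((i : ℝ≥0) / n) ω)) *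
        ((n : ℝ) ^ H * (B ((j' : ℝ≥0) / n) ω - B ((j : ℝ≥0) / n) ω)) =
      (n : ℝ) ^ (2 * H) * ((B ((i' : ℝ≥0) / n) ω - B ((i : ℝ≥0) / n) ω) *
        (B ((j' : ℝ≥0) / n) ω - B ((j : ℝ≥0) / n) ω)) := fun ω => by
    rw [two_mul, Real.rpow_add hn0]
    ring
  have hs : ∀ a b : ℕ, |(((a : ℝ≥0) / n : ℝ≥0) : ℝ) - (((b : ℝ≥0) / n : ℝ≥0) : ℝ)| ^ (2 * H) =
      |(a : ℝ) - b| ^ (2 * H) / (n : ℝ) ^ (2 * H) := fun a b => by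
    push_cast
    rw [← sub_div, abs_div, abs_of_pos hn0, Real.div_rpow (abs_nonneg _) hn0.le]
  simp only [he]
  rw [integral_const_mul, hB.integral_incr_mul_incr]
  simp only [hs]
  have hnH : (n : ℝ) ^ (2 * H) ≠ 0 := by positivity
  field_simp

theorem integral_scaledIncr_mul (hB : IsFractionalBrownianMotion H B μ) {n : ℕ} (hn : n ≠ 0)
    (i j : ℕ) : ∫ ω, scaledIncr H B n i ω * scaledIncr H B n j ω ∂μ =
      (|(i : ℝ) - j + 1| ^ (2 * H) + |(i : ℝ) - j - 1| ^ (2 * H)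
        - 2 * |(i : ℝ) - j| ^ (2 * H)) / 2 := by
  have h := hB.integral_scaled_incr_mul_incr hn i (i + 1) j (j + 1)
  simp only [scaledIncr]
  rw [h]
  push_cast
  rw [show (i : ℝ) + 1 - j = i - j + 1 by ring, show (i : ℝ) - (j + 1) = i - j - 1 by ring,
    show (i : ℝ) + 1 - (j + 1) = i - j by ring]
  ring

theorem integral_scaledIncr_sq (hB : IsFractionalBrownianMotion H B μ) (hH : 0 < H) {n : ℕ}
    (hn : n ≠ 0) (i : ℕ) : ∫ ω, scaledIncr H B n i ω ^ 2 ∂μ = 1 := by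
  have h := hB.integral_scaledIncr_mul hn i i
  have h0 : (0 : ℝ) ^ (2 * H) = 0 := Real.zero_rpow (by positivity)
  simp only [← sq] at h
  rw [h]
  simp [h0]

theorem abs_integral_scaledIncr_mul_le (hB : IsFractionalBrownianMotion H B μ) (hH : 0 < H)
    {n : ℕ} (hn : n ≠ 0) (i j : ℕ) :
    |∫ ω, scaledIncr H B n i ω * scaledIncr H B n j ω ∂μ| ≤ 1 := by
  have hG := (hB.isGaussianProcess_scaledIncr n).hasGaussianLaw_eval
  have h2 := fun i => HasGaussianLaw.integrable_pow (hG i) 2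
  calc |∫ ω, scaledIncr H B n i ω * scaledIncr H B n j ω ∂μ|
      ≤ ∫ ω, |scaledIncr H B n i ω * scaledIncr H B n j ω| ∂μ := abs_integral_le_integral_abs
    _ ≤ ∫ ω, (scaledIncr H B n i ω ^ 2 + scaledIncr H B n j ω ^ 2) / 2 ∂μ := by
        refine integral_mono (integrable_mul_of_hasGaussianLaw (hG i) (hG j)).abs
          (((h2 i).add (h2 j)).div_const 2) fun ω => ?_
        simp only [abs_mul]
        nlinarith [sq_nonneg (|scaledIncr H B n i ω| - |scaledIncr H B n j ω|),
          sq_abs (scaledIncr H B n i ω), sq_abs (scaledIncr H B n j ω)]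
    _ = 1 := by
        rw [integral_div, integral_add (h2 i) (h2 j), hB.integral_scaledIncr_sq hH hn,
          hB.integral_scaledIncr_sq hH hn]
        norm_num

/-- The double sum is the second moment of the sum of the increments, which telescopes to one
increment of length `d / n`. -/
theorem sum_sum_integral_scaledIncr_mul (hB : IsFractionalBrownianMotion H B μ) (hH : 0 < H)
    {n : ℕ} (hn : n ≠ 0) (s d : ℕ) :
    ∑ i ∈ Finset.Ico s (s + d), ∑ j ∈ Finset.Ico s (s + d),
      ∫ ω, scaledIncr H B n i ω * scaledIncr H B n j ω ∂μ = (d : ℝ) ^ (2 * H) := by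
  have hG := (hB.isGaussianProcess_scaledIncr n).hasGaussianLaw_eval
  have hi := fun i j => integrable_mul_of_hasGaussianLaw (hG i) (hG j)
  have htel : ∀ ω, ∑ i ∈ Finset.Ico s (s + d), scaledIncr H B n i ω =
      (n : ℝ) ^ H * (B (((s + d : ℕ) : ℝ≥0) / n) ω - B ((s : ℝ≥0) / n) ω) := fun ω => by
    simp only [scaledIncr]
    rw [← Finset.mul_sum, Finset.sum_Ico_sub (fun i : ℕ => B ((i : ℝ≥0) / n) ω)
      (Nat.le_add_right s d)]
  have h := hB.integral_scaled_incr_mul_incr hn s (s + d) s (s + d)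
  simp only [← htel] at h
  simp only [Finset.sum_mul_sum] at h
  rw [integral_finsetSum _ fun i _ => integrable_finsetSum _ fun j _ => hi i j] at h
  rw [Finset.sum_congr rfl fun i _ => integral_finsetSum _ fun j _ => hi i j] at h
  rw [h]
  have h0 : (0 : ℝ) ^ (2 * H) = 0 := Real.zero_rpow (by positivity)
  simp [h0]

/-- The sum of `d` consecutive squared scaled increments has variance `O(d ^ max 1 (2 * H))`. -/
theorem integral_sq_sum_scaledIncr_sq_le (hB : IsFractionalBrownianMotion H B μ) (hH : 0 < H)
    {n : ℕ} (hn : n ≠ 0) (s d : ℕ) :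
    Integrable (fun ω => (∑ i ∈ Finset.Ico s (s + d), (scaledIncr H B n i ω ^ 2 - 1)) ^ 2) μ ∧
    ∫ ω, (∑ i ∈ Finset.Ico s (s + d), (scaledIncr H B n i ω ^ 2 - 1)) ^ 2 ∂μ ≤
      4 * (d : ℝ) ^ max 1 (2 * H) := by
  obtain ⟨h1, h2⟩ := integral_sq_sum_sq_sub_one (hB.isGaussianProcess_scaledIncr n)
    (hB.integral_scaledIncr n) (Finset.Ico s (s + d))
    (fun i _ => hB.integral_scaledIncr_sq hH hn i)
  refine ⟨h1, ?_⟩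
  rw [h2]
  have hT := hB.sum_sum_integral_scaledIncr_mul hH hn s d
  have hle := hB.abs_integral_scaledIncr_mul_le hH hn
  have hdiag : ∀ i, ∫ ω, scaledIncr H B n i ω * scaledIncr H B n i ω ∂μ = 1 := fun i => by
    simpa only [sq] using hB.integral_scaledIncr_sq hH hn i
  have habs : ∀ i j : ℕ, i ≠ j → 1 ≤ |(i : ℝ) - j| := fun i j hij => by
    have : (1 : ℤ) ≤ |(i : ℤ) - j| := Int.one_le_abs (by omega)
    exact_mod_cast this
  -- Correlations are second differences of `|x| ^ (2H)`: convexity makes them nonnegative in the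
  -- first case, concavity nonpositive off the diagonal in the second.
  rcases le_total 1 (2 * H) with h | h
  · have := sum_sq_le_of_nonneg (Finset.Ico s (s + d)) (fun i _ j _ => hle i j)
      (fun i _ j _ => by
        rcases eq_or_ne i j with rfl | hij
        · rw [hdiag]
          exact zero_le_one
        · rw [hB.integral_scaledIncr_mul hn]
          linarith [two_mul_rpow_le_of_one_le_abs h (habs i j hij)])
    rw [max_eq_right h]
    rw [hT] at this
    have h0 : (0 : ℝ) ≤ (d : ℝ) ^ (2 * H) := by positivity
    linarith
  · have := sum_sq_le_of_nonpos (Finset.Ico s (s + d)) (fun i _ j _ => hle i j)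
      (fun i _ => hdiag i) (fun i _ j _ hij => by
        rw [hB.integral_scaledIncr_mul hn]
        linarith [rpow_add_rpow_le_of_one_le_abs (by positivity) h (habs i j hij)])
    rw [max_eq_left h, Real.rpow_one]
    rw [hT, Nat.card_Ico, Nat.add_sub_cancel_left] at this
    have h0 : (0 : ℝ) ≤ (d : ℝ) ^ (2 * H) := by positivity
    linarith

end IsFractionalBrownianMotion

/-! ### Uniform near-linearity on either side of an index -/

theorem sum_range_sub_one_sub_eq_sum_Ico (f : ℕ → ℝ) {q e : ℕ} (he : e ≤ q) :
    ∑ i ∈ Finset.range e, f (q - 1 - i) = ∑ i ∈ Finset.Ico (q - e) q, f i := by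
  induction e with
  | zero => simp
  | succ e ih =>
    rw [Finset.sum_range_succ, ih (by omega),
      Finset.sum_eq_sum_Ico_succ_bot (show q - (e + 1) < q by omega),
      show q - (e + 1) + 1 = q - e by omega, show q - (e + 1) = q - 1 - e by omega, add_comm]

namespace IsFractionalBrownianMotion

variable {Ω : Type*} [MeasurableSpace Ω] {μ : Measure Ω} {H : ℝ} {B : ℝ≥0 → Ω → ℝ}

theorem exists_forall_measure_forward_le [IsFiniteMeasure μ]
    (hB : IsFractionalBrownianMotion H B μ) (hH : H ∈ Set.Ioo (0 : ℝ) 1)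
    {δ ε : ℝ} (hδ : 0 < δ) (hε : 0 < ε) :
    ∃ D : ℕ, 1 ≤ D ∧ ∀ n p : ℕ, n ≠ 0 →
      μ {ω | ∃ d ≥ D, δ * d < |∑ i ∈ Finset.Ico p (p + d), (scaledIncr H B n i ω ^ 2 - 1)|} ≤
        ENNReal.ofReal ε := by
  obtain ⟨D, hD1, hD⟩ := exists_forall_measure_exists_lt_abs_sum_le μ (C := 4)
    (β := max 1 (2 * H)) (by norm_num) (max_lt one_lt_two (by linarith [hH.2])) hδ hε
  refine ⟨D, hD1, fun n p hn => ?_⟩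
  have hs : ∀ d ω, ∑ i ∈ Finset.Ico p (p + d), (scaledIncr H B n i ω ^ 2 - 1) =
      ∑ i ∈ Finset.range d, (scaledIncr H B n (p + i) ω ^ 2 - 1) := fun d ω => by
    rw [Finset.sum_Ico_eq_sum_range, Nat.add_sub_cancel_left]
  have hv := fun d => hB.integral_sq_sum_scaledIncr_sq_le hH.1 hn p d
  simp only [hs] at hv ⊢
  exact hD (fun i ω => scaledIncr H B n (p + i) ω ^ 2) (fun i ω => sq_nonneg _)
    (fun d => (hv d).1) (fun d => (hv d).2)

theorem exists_forall_measure_backward_le [IsFiniteMeasure μ]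
    (hB : IsFractionalBrownianMotion H B μ) (hH : H ∈ Set.Ioo (0 : ℝ) 1)
    {δ ε : ℝ} (hδ : 0 < δ) (hε : 0 < ε) :
    ∃ D : ℕ, 1 ≤ D ∧ ∀ n q : ℕ, n ≠ 0 →
      μ {ω | ∃ d ≥ D, d ≤ q ∧
        δ * d < |∑ i ∈ Finset.Ico (q - d) q, (scaledIncr H B n i ω ^ 2 - 1)|} ≤
          ENNReal.ofReal ε := by
  obtain ⟨D, hD1, hD⟩ := exists_forall_measure_exists_lt_abs_sum_le μ (C := 4)
    (β := max 1 (2 * H)) (by norm_num) (max_lt one_lt_two (by linarith [hH.2])) hδ hε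
  refine ⟨D, hD1, fun n q hn => ?_⟩
  -- Increments are read backwards from `q`; past the origin the value 1 pads the sequence,
  -- contributing nothing after centering.
  set y : ℕ → Ω → ℝ := fun i ω => if i < q then scaledIncr H B n (q - 1 - i) ω ^ 2 else 1 with hy
  have hs : ∀ d ω, ∑ i ∈ Finset.range d, (y i ω - 1) =
      ∑ i ∈ Finset.Ico (q - min d q) (q - min d q + min d q),
        (scaledIncr H B n i ω ^ 2 - 1) := fun d ω => by
    rw [Nat.sub_add_cancel (min_le_right d q), ← sum_range_sub_one_sub_eq_sum_Ico
      (fun i => scaledIncr H B n i ω ^ 2 - 1) (min_le_right d q)]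
    refine (Finset.sum_subset_zero_on_sdiff (Finset.range_mono (min_le_left d q))
      (fun i hi => ?_) fun i hi => ?_).symm
    · have : ¬ i < q := by
        simp only [Finset.mem_sdiff, Finset.mem_range] at hi
        omega
      simp [hy, this]
    · have : i < q := by
        simp only [Finset.mem_range] at hi
        omega
      simp [hy, this]
  have hv := fun d => hB.integral_sq_sum_scaledIncr_sq_le hH.1 hn (q - min d q) (min d q)
  simp only [← hs] at hv
  refine (measure_mono ?_).trans (hD y (fun i ω => ?_) (fun d => (hv d).1) fun d => ?_)
  · rintro ω ⟨d, hd, hdq, hlt⟩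
    refine ⟨d, hd, ?_⟩
    rwa [hs, min_eq_left hdq, Nat.sub_add_cancel hdq]
  · simp only [hy]
    split_ifs
    · exact sq_nonneg _
    · exact zero_le_one
  · refine (hv d).2.trans ?_
    gcongr
    exact min_le_left d q

end IsFractionalBrownianMotion

/-! ### The observed process and the rate -/

theorem abs_cusum_le_iff {w : ℤ → ℝ} {z : ℝ≥0 → ℝ} {n : ℕ} (hn : n ≠ 0) (l m : ℕ) :
    |cusum w z n l| ≤ |cusum w z n m| ↔
      |∑ i ∈ Finset.range l, sqIncr z n (i + 1) -
          l * ((∑ i ∈ Finset.range n, sqIncr z n (i + 1)) / n)| ≤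
        |∑ i ∈ Finset.range m, sqIncr z n (i + 1) -
          m * ((∑ i ∈ Finset.range n, sqIncr z n (i + 1)) / n)| := by
  have hst : 0 < standardizer w z n := by
    unfold standardizer
    split_ifs with h
    · exact Real.sqrt_pos.2 h
    · exact one_pos
  have hsum : ∀ k, ∑ j ∈ Finset.Icc 1 k, sqIncr z n j =
      ∑ i ∈ Finset.range k, sqIncr z n (i + 1) := fun k => by
    rw [Finset.range_eq_Ico, Finset.sum_Ico_add' (fun j => sqIncr z n j)]
    rfl
  have hn0 : (0 : ℝ) < n := by positivity
  have hpos : 0 < 1 / Real.sqrt n / standardizer w z n := by positivity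
  have hc : ∀ k : ℕ, |cusum w z n k| = 1 / Real.sqrt n / standardizer w z n *
      |∑ i ∈ Finset.range k, sqIncr z n (i + 1) -
          k * ((∑ i ∈ Finset.range n, sqIncr z n (i + 1)) / n)| := fun k => by
    nth_rewrite 1 [← abs_of_pos hpos]
    rw [← abs_mul]
    congr 1
    unfold cusum meanSqIncr
    rw [Finset.sum_sub_distrib, hsum, hsum]
    simp only [Finset.sum_const, Nat.card_Icc, nsmul_eq_mul, Nat.add_sub_cancel]
    ring
  rw [hc, hc, mul_le_mul_iff_right₀ hpos]

theorem eventually_rpow_neg_le_mul {h h' δ : ℝ} (hh : h < h') (hδ : 0 < δ) :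
    ∀ᶠ n : ℕ in Filter.atTop, (n : ℝ) ^ (-(2 * h')) ≤ δ * (n : ℝ) ^ (-(2 * h)) := by
  have ht : Filter.Tendsto (fun n : ℕ => (n : ℝ) ^ (-(2 * (h' - h)))) Filter.atTop (nhds 0) :=
    (tendsto_rpow_neg_atTop (by linarith : 0 < 2 * (h' - h))).comp tendsto_natCast_atTop_atTop
  filter_upwards [ht.eventually (eventually_le_nhds hδ), Filter.eventually_gt_atTop 0] with n hn hn0
  have hn0' : (0 : ℝ) < n := by exact_mod_cast hn0
  rw [show -(2 * h') = -(2 * (h' - h)) + -(2 * h) by ring, Real.rpow_add hn0']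
  gcongr

theorem sq_mul_eq_mul_sq_scaledIncr {Ω : Type*} (σ H : ℝ) (B : ℝ≥0 → Ω → ℝ) {n : ℕ} (hn : n ≠ 0)
    (i : ℕ) (ω : Ω) :
    (σ * (B (((i + 1 : ℕ) : ℝ≥0) / n) ω - B ((i : ℝ≥0) / n) ω)) ^ 2 =
      σ ^ 2 * (n : ℝ) ^ (-(2 * H)) * scaledIncr H B n i ω ^ 2 := by
  have hn0 : (0 : ℝ) < n := by positivity
  have h : (n : ℝ) ^ (-(2 * H)) * ((n : ℝ) ^ H) ^ 2 = 1 := by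
    rw [← Real.rpow_natCast, ← Real.rpow_mul hn0.le, ← Real.rpow_add hn0]
    norm_num
    rw [show -(2 * H) + H * 2 = 0 by ring, Real.rpow_zero]
  unfold scaledIncr
  rw [mul_pow ((n : ℝ) ^ H), mul_pow]
  linear_combination
    (-(σ ^ 2 * (B (((i + 1 : ℕ) : ℝ≥0) / n) ω - B ((i : ℝ≥0) / n) ω) ^ 2)) * h

theorem abs_sum_sub_mul_le_of_eq_mul {f g : ℕ → ℝ} {a δ : ℝ} (ha : 0 < a) {s t : ℕ} (hst : s ≤ t)
    (hfg : ∀ i ∈ Finset.Ico s t, f i = a * g i)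
    (h : |∑ i ∈ Finset.Ico s t, (g i - 1)| ≤ δ * ((t - s : ℕ) : ℝ)) :
    |∑ i ∈ Finset.range t, f i - ∑ i ∈ Finset.range s, f i - a * ((t - s : ℕ) : ℝ)| ≤
      δ * (a * ((t - s : ℕ) : ℝ)) := by
  have he : ∑ i ∈ Finset.range t, f i - ∑ i ∈ Finset.range s, f i - a * ((t - s : ℕ) : ℝ) =
      a * ∑ i ∈ Finset.Ico s t, (g i - 1) := by
    rw [← Finset.sum_Ico_eq_sub _ hst, Finset.sum_congr rfl hfg, ← Finset.mul_sum,
      Finset.sum_sub_distrib]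
    simp
    ring
  rw [he, abs_mul, abs_of_pos ha]
  calc a * _ ≤ a * (δ * ((t - s : ℕ) : ℝ)) := by gcongr
    _ = _ := by ring

/-- Off the events on which the scaled squared increments next to the change point are far from
their means, the cusum argmax is within `D` of the change point. -/
theorem cusum_argmax_near_of_hurst_change {Ω : Type*} {σ H H' θ ξ c : ℝ} {z : ℝ≥0 → ℝ}
    {B B' : ℝ≥0 → Ω → ℝ} {ω : Ω} {w : ℤ → ℝ} {n D m : ℕ} (hσ : 0 < σ) (hθ0 : 0 < θ)
    (hz : ∀ t : ℝ≥0, t ≤ 1 →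
      ((t : ℝ) < θ → z t = σ * B t ω) ∧ (θ ≤ (t : ℝ) → z t = ξ + σ * B' t ω))
    (hc0 : 0 < c) (hcθ : 2 * c ≤ θ) (hcθ' : 2 * c ≤ 1 - θ) (hD : 1 ≤ D) (hDn : D + 1 ≤ c * n)
    (hab : (n : ℝ) ^ (-(2 * H')) ≤ c ^ 2 / 32 * (n : ℝ) ^ (-(2 * H)) ∨
      (n : ℝ) ^ (-(2 * H)) ≤ c ^ 2 / 32 * (n : ℝ) ^ (-(2 * H')))
    (hleft : ∀ d ≥ D, d ≤ ⌈n * θ⌉₊ - 1 →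
      |∑ i ∈ Finset.Ico (⌈n * θ⌉₊ - 1 - d) (⌈n * θ⌉₊ - 1), (scaledIncr H B n i ω ^ 2 - 1)| ≤
        c ^ 2 / 32 * d)
    (hright : ∀ d ≥ D,
      |∑ i ∈ Finset.Ico ⌈n * θ⌉₊ (⌈n * θ⌉₊ + d), (scaledIncr H' B' n i ω ^ 2 - 1)| ≤
        c ^ 2 / 32 * d)
    (hm : IsCusumArgmax w z n m) : ⌈n * θ⌉₊ ≤ m + D ∧ m < ⌈n * θ⌉₊ + D := by
  have hn : n ≠ 0 := by
    rintro rfl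
    norm_num at hDn
    linarith [Nat.cast_nonneg (α := ℝ) D]
  have hn0 : (0 : ℝ) < n := by positivity
  -- `p` is the first grid index at or after `θ`; counted from 0, increment `p - 1` straddles the
  -- change.
  set p := ⌈n * θ⌉₊ with hp
  have hpθ : n * θ ≤ p := Nat.le_ceil _
  have hpθ' : (p : ℝ) < n * θ + 1 := Nat.ceil_lt_add_one (by positivity)
  have hnθ : n * (2 * c) ≤ n * θ := by gcongr
  have hnθ' : n * (2 * c) ≤ n * (1 - θ) := by gcongr
  have hD0 : (1 : ℝ) ≤ D := by exact_mod_cast hD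
  have hpn : p ≤ n := by
    have : (p : ℝ) < n := by linarith
    exact_mod_cast this.le
  obtain ⟨r, hr⟩ := Nat.exists_eq_add_of_le hpn
  have hp1 : 1 ≤ p := by
    have : (1 : ℝ) ≤ p := by linarith
    exact_mod_cast this
  obtain ⟨q, hq⟩ := Nat.exists_eq_add_of_le' hp1
  rw [hq, Nat.add_sub_cancel] at hleft
  have hnq : q + 1 + r = n := by omega
  have hqR : (p : ℝ) = q + 1 := by rw [hq]; push_cast; ring
  have hrR : (n : ℝ) = p + r := by rw [hr]; push_cast; ring
  have hqc : c * n ≤ q := by linarith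
  have hrc : c * n ≤ r := by linarith
  have hDq : D ≤ q := by
    have : (D : ℝ) ≤ q := by linarith
    exact_mod_cast this
  have hDr : D ≤ r := by
    have : (D : ℝ) ≤ r := by linarith
    exact_mod_cast this
  have htime : ∀ k ≤ n, (k : ℝ≥0) / n ≤ 1 := fun k hk => by
    rw [div_le_one (by positivity)]
    exact_mod_cast hk
  have hbefore : ∀ k < p, (((k : ℝ≥0) / n : ℝ≥0) : ℝ) < θ := fun k hk => by
    push_cast
    rw [div_lt_iff₀ hn0, mul_comm]
    exact Nat.lt_ceil.1 hk
  have hafter : ∀ k ≥ p, θ ≤ (((k : ℝ≥0) / n : ℝ≥0) : ℝ) := fun k hk => by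
    push_cast
    rw [le_div_iff₀ hn0, mul_comm]
    exact Nat.ceil_le.1 hk
  have hxl : ∀ i < q, sqIncr z n (i + 1) =
      σ ^ 2 * (n : ℝ) ^ (-(2 * H)) * scaledIncr H B n i ω ^ 2 := fun i hi => by
    rw [← sq_mul_eq_mul_sq_scaledIncr σ H B hn, sqIncr, Nat.add_sub_cancel,
      (hz _ (htime (i + 1) (by omega))).1 (hbefore (i + 1) (by omega)),
      (hz _ (htime i (by omega))).1 (hbefore i (by omega))]
    ring
  have hxr : ∀ i ≥ p, i < n → sqIncr z n (i + 1) =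
      σ ^ 2 * (n : ℝ) ^ (-(2 * H')) * scaledIncr H' B' n i ω ^ 2 := fun i hi hin => by
    rw [← sq_mul_eq_mul_sq_scaledIncr σ H' B' hn, sqIncr, Nat.add_sub_cancel,
      (hz _ (htime (i + 1) (by omega))).2 (hafter (i + 1) (by omega)),
      (hz _ (htime i (by omega))).2 (hafter i hi)]
    ring
  have hσ2 : 0 < σ ^ 2 := by positivity
  have ha : 0 < σ ^ 2 * (n : ℝ) ^ (-(2 * H)) := by positivity
  have hb : 0 < σ ^ 2 * (n : ℝ) ^ (-(2 * H')) := by positivity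
  have hm1 := Finset.mem_Icc.1 hm.1
  have hres := cusum_argmax_near (F := fun k => ∑ i ∈ Finset.range k, sqIncr z n (i + 1))
    (q := q) (r := r) (D := D) (m := m) (c := c)
    (fun k l hkl => Finset.sum_le_sum_of_subset_of_nonneg (Finset.range_mono hkl)
      fun i _ _ => sq_nonneg _) (by simp) ha hb hc0 (by linarith)
    (hab.imp (fun h => by
      rw [mul_left_comm]
      exact mul_le_mul_of_nonneg_left h hσ2.le) fun h => by
      rw [mul_left_comm]
      exact mul_le_mul_of_nonneg_left h hσ2.le)
    (by rwa [hnq]) (by rwa [hnq]) hD hDq hDr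
    (fun i d hid hd => by
      have h := abs_sum_sub_mul_le_of_eq_mul (f := fun i => sqIncr z n (i + 1))
        (g := fun i => scaledIncr H B n i ω ^ 2) (s := q - d) (t := q) (δ := c ^ 2 / 32) ha
        (Nat.sub_le q d) (fun i hi => hxl i (Finset.mem_Ico.1 hi).2)
        (by rw [show q - (q - d) = d by omega]; exact hleft d hd (by omega))
      rw [show q - (q - d) = d by omega, show q - d = i by omega] at h
      exact h)
    (fun d hdr hd => by
      have h := abs_sum_sub_mul_le_of_eq_mul (f := fun i => sqIncr z n (i + 1))
        (g := fun i => scaledIncr H' B' n i ω ^ 2) (s := p) (t := p + d) (δ := c ^ 2 / 32) hb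
        (Nat.le_add_right p d) (fun i hi => hxr i (Finset.mem_Ico.1 hi).1
          (by have := (Finset.mem_Ico.1 hi).2; omega))
        (by rw [Nat.add_sub_cancel_left]; exact hright d hd)
      rw [Nat.add_sub_cancel_left, hq] at h
      exact h)
    (by omega)
    (fun l hl => by
      rw [hnq] at hl ⊢
      -- The deterministic lemma also compares with `l = 0`, outside the range of the maximizer; the
      -- cusum is 0 there.
      rcases Nat.eq_zero_or_pos l with rfl | hl0
      · simp
      · exact (abs_cusum_le_iff hn l m).1 (hm.2 l (Finset.mem_Icc.2 ⟨hl0, hl⟩)))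
  omega

theorem proposition1 {Ω : Type*} [MeasurableSpace Ω] (μ : Measure Ω) [IsProbabilityMeasure μ]
    (σ H H' θ : ℝ) (hσ : 0 < σ) (hH : H ∈ Set.Ioo (0 : ℝ) 1) (hH' : H' ∈ Set.Ioo (0 : ℝ) 1)
    (hne : H ≠ H') (hθ : θ ∈ Set.Ioo (0 : ℝ) 1)
    (Z : ℝ≥0 → Ω → ℝ) (hZ : IsHurstChange μ σ H H' θ Z)
    (w : ℕ → ℤ → ℝ) (mhat : ℕ → Ω → ℕ)
    (hmhat : ∀ n : ℕ, 1 ≤ n → ∀ ω, IsCusumArgmax (w n) (fun t => Z t ω) n (mhat n ω)) :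
    IsBigOInProbability μ (fun n ω => |(1 / (n : ℝ)) * (mhat n ω : ℝ) - θ|)
      (fun n => Real.log n * (n : ℝ) ^ (-(1 / 2) : ℝ)) := by
  intro ε hε
  obtain ⟨B, B', ξ, hB, hB', hBZ⟩ := hZ
  set c : ℝ := min θ (1 - θ) / 2 with hc
  have hc0 : 0 < c := by
    have : 0 < min θ (1 - θ) := lt_min hθ.1 (by linarith [hθ.2])
    positivity
  have hcθ : 2 * c ≤ θ := by linarith [min_le_left θ (1 - θ)]
  have hcθ' : 2 * c ≤ 1 - θ := by linarith [min_le_right θ (1 - θ)]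
  have hδ : 0 < c ^ 2 / 32 := by positivity
  obtain ⟨D₁, hD₁, hbwd⟩ := hB.exists_forall_measure_backward_le hH hδ
    (show 0 < ε / 3 by positivity)
  obtain ⟨D₂, hD₂, hfwd⟩ := hB'.exists_forall_measure_forward_le hH' hδ
    (show 0 < ε / 3 by positivity)
  set D := max D₁ D₂ with hD
  have hratio : ∀ᶠ n : ℕ in Filter.atTop,
      ((n : ℝ) ^ (-(2 * H')) ≤ c ^ 2 / 32 * (n : ℝ) ^ (-(2 * H)) ∨
        (n : ℝ) ^ (-(2 * H)) ≤ c ^ 2 / 32 * (n : ℝ) ^ (-(2 * H'))) := by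
    rcases lt_or_gt_of_ne hne with h | h
    · exact (eventually_rpow_neg_le_mul h hδ).mono fun n => Or.inl
    · exact (eventually_rpow_neg_le_mul h hδ).mono fun n => Or.inr
  have hlarge : ∀ᶠ n : ℕ in Filter.atTop, (D : ℝ) + 1 ≤ c * n :=
    (tendsto_natCast_atTop_atTop.const_mul_atTop hc0).eventually_ge_atTop _
  have hlog : ∀ᶠ n : ℕ in Filter.atTop, (D : ℝ) + 1 ≤ Real.log n :=
    (Real.tendsto_log_atTop.comp tendsto_natCast_atTop_atTop).eventually_ge_atTop _
  obtain ⟨n₀, hn₀⟩ := Filter.eventually_atTop.1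
    (hratio.and (hlarge.and (hlog.and (Filter.eventually_ge_atTop 1))))
  -- `K = 1` suffices: the error is at most `(D + 1) / n`, and `log n` eventually exceeds the
  -- constant `D + 1`.
  refine ⟨1, one_pos, n₀, fun n hn => ?_⟩
  obtain ⟨hab, hDn, hDlog, hn1⟩ := hn₀ n hn
  have hn0 : n ≠ 0 := by omega
  have hnR : (1 : ℝ) ≤ n := by exact_mod_cast hn1
  have hnpos : (0 : ℝ) < n := by linarith
  refine (measure_mono ?_).trans_lt (((measure_union_le _ _).trans (add_le_add
    (hbwd n (⌈n * θ⌉₊ - 1) hn0) (hfwd n ⌈n * θ⌉₊ hn0))).trans_lt ?_)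
  · intro ω hω
    by_contra hgood
    simp only [Set.mem_union, Set.mem_ofPred_eq, not_or, not_exists, not_and, not_lt] at hgood
    obtain ⟨hleft, hright⟩ := hgood
    obtain ⟨h1, h2⟩ := cusum_argmax_near_of_hurst_change hσ hθ.1
      (fun t ht => hBZ t ht ω) hc0 hcθ hcθ' (hD₁.trans (le_max_left D₁ D₂)) hDn hab
      (fun d hd => hleft d ((le_max_left D₁ D₂).trans hd))
      (fun d hd => hright d ((le_max_right D₁ D₂).trans hd)) (hmhat n hn1 ω)
    have h1' : (⌈n * θ⌉₊ : ℝ) ≤ mhat n ω + D := by exact_mod_cast h1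
    have h2' : (mhat n ω : ℝ) < ⌈n * θ⌉₊ + D := by exact_mod_cast h2
    have h3 : n * θ ≤ ⌈n * θ⌉₊ := Nat.le_ceil _
    have h4 : (⌈n * θ⌉₊ : ℝ) < n * θ + 1 :=
      Nat.ceil_lt_add_one (mul_nonneg hnpos.le hθ.1.le)
    have h5 : |1 / (n : ℝ) * mhat n ω - θ| ≤ (D + 1) * (1 / n) := by
      have : 1 / (n : ℝ) * mhat n ω - θ = (mhat n ω - n * θ) * (1 / n) := by field_simp
      rw [this, abs_mul, abs_of_pos (show 0 < 1 / (n : ℝ) by positivity)]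
      gcongr
      rw [abs_le]
      constructor <;> linarith
    have h6 : 1 / (n : ℝ) ≤ (n : ℝ) ^ (-(1 / 2) : ℝ) := by
      rw [one_div, ← Real.rpow_neg_one]
      exact Real.rpow_le_rpow_of_exponent_le hnR (by norm_num)
    have h7 : ((D : ℝ) + 1) * (1 / n) ≤ Real.log n * (n : ℝ) ^ (-(1 / 2) : ℝ) := by gcongr
    rw [Set.mem_ofPred_eq, one_mul, abs_abs] at hω
    exact absurd hω (not_lt.2 (h5.trans (h7.trans (le_abs_self _))))
  · rw [← ENNReal.ofReal_add (by positivity) (by positivity)]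
    exact (ENNReal.ofReal_lt_ofReal_iff hε).2 (by linarith)
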